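/- All vector spaces, vertex operator algebras (VOAs) and Hopf algebras are over $\mathbb{C}$. A VOA $V=(V,Y,\mathbf 1,\omega)$, with $Y(u,z)v=\sum_{n\in\mathbb Z}u_nv\,z^{-n-1}$, has a $\mathbb{Z}$-grading by finite-dimensional subspaces $V_n$, with $V_n=0$ for $n\ll 0$. It is simple if $V\neq0$ and the only subspaces of $V$ stable under all $u_n$ ($u\in V$, $n\in\mathbb{Z}$) are $0$ and $V$. For a Hopf algebra $H$ with comultiplication $\Delta(h)=\sum h_1\otimes h_2$, counit $\epsilon$ and antipode $S$, an $H$-module VOA is a VOA $V$ with a left $H$-module structure such that $h\omega=\epsilon(h)\omega$ and $h\,(Y(u,z)v)=\sum Y(h_1u,z)\,h_2v$ for all $h\in H$ and $u,v\in V$. A Hopf ideal of $H$ is a two-sided ideal $I$ with $\Delta(I)\subseteq H\otimes I+I\otimes H$, $\epsilon(I)=0$ and $S(I)\subseteq I$. The $H$-module $V$ is inner faithful if $IV\neq0$ for every nonzero Hopf ideal $I$ of $H$. **Theorem.** Let $H$ be a finite-dimensional Hopf algebra and let $V$ be an $H$-module VOA that is simple as a VOA and semisimple as an $H$-module. Then: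 1. the kernel $K=\{h\in H: hV=0\}$ of the action is a Hopf ideal of $H$; 2. $V$ is an inner faithful $H$-module if and only if it is a faithful $H$-module, i.e. $K=0$; 3. if $V$ is inner faithful, then $H$ is a group algebra, i.e. $H\cong\mathbb{C}[G]$ as Hopf algebras for some group $G$. -/

import Mathlib

open scoped TensorProduct

noncomputable section

/-- The data of a `ℤ`-graded complex vector space `V = ⨁ Vₙ` with a state-field map
`u ↦ Y(u, z)`, a vacuum vector, a conformal vector and a central charge. Each `Y(u, z) v` is a
formal Laurent series (this is the truncation condition `uₙ v = 0` for `n ≫ 0`), linear in `u`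
and in `v`. -/
structure VOAData (V : Type*) [AddCommGroup V] [Module ℂ V] where
  grade : ℤ → Submodule ℂ V
  Y : V →ₗ[ℂ] VertexOperator ℂ V
  vacuum : V
  conformal : V
  centralCharge : ℂ

namespace VOAData

variable {V : Type*} [AddCommGroup V] [Module ℂ V] (A : VOAData V)

/-- `A.mode n u v = uₙ v`, where `Y(u, z) v = ∑ₙ uₙ v z⁻ⁿ⁻¹`. -/
def mode (n : ℤ) : V →ₗ[ℂ] V →ₗ[ℂ] V :=
  (LinearMap.proj n ∘ₗ VertexOperator.ncoeff) ∘ₗ A.Y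

theorem mode_apply (n : ℤ) (u v : V) :
    A.mode n u v = VertexOperator.ncoeff (A.Y u) n v := rfl

/-- `L(n) = ω_{n+1}`, i.e. `Y(ω, z) = ∑ₙ L(n) z⁻ⁿ⁻²`. -/
def L (n : ℤ) : Module.End ℂ V := A.mode (n + 1) A.conformal

end VOAData

/-- A vertex operator algebra over `ℂ` with underlying vector space `V`. -/
structure VertexOperatorAlgebra (V : Type*) [AddCommGroup V] [Module ℂ V]
    extends VOAData V where
  isInternal_grade : DirectSum.IsInternal grade
  finite_grade : ∀ n, Module.Finite ℂ (grade n)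
  grade_eq_bot : ∃ N : ℤ, ∀ n < N, grade n = ⊥
  vacuum_mem : vacuum ∈ grade 0
  conformal_mem : conformal ∈ grade 2
  /-- `Y(𝟏, z) v = v`. -/
  vacuum_mode : ∀ (n : ℤ) (v : V), toVOAData.mode n vacuum v = if n = -1 then v else 0
  /-- `Y(v, z)𝟏` has no negative powers of `z` … -/
  mode_vacuum_of_nonneg : ∀ (n : ℤ) (v : V), 0 ≤ n → toVOAData.mode n v vacuum = 0
  /-- … and its constant term is `v`. -/
  mode_vacuum : ∀ v : V, toVOAData.mode (-1) v vacuum = v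
  /-- `Vₙ` is the eigenspace of `L(0)` for the eigenvalue `n`. -/
  mem_grade_iff : ∀ (n : ℤ) (v : V), v ∈ grade n ↔ toVOAData.L 0 v = (n : ℂ) • v
  /-- `Y(L(-1)u, z) = d/dz Y(u, z)`. -/
  mode_L_neg_one : ∀ (n : ℤ) (u v : V),
    toVOAData.mode n (toVOAData.L (-1) u) v = -(n : ℂ) • toVOAData.mode (n - 1) u v
  /-- The Virasoro relations. -/
  virasoro : ∀ (m n : ℤ) (v : V),
    toVOAData.L m (toVOAData.L n v) - toVOAData.L n (toVOAData.L m v) =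
      ((m : ℂ) - n) • toVOAData.L (m + n) v +
        (if m + n = 0 then ((m : ℂ) ^ 3 - m) / 12 * centralCharge else 0) • v
  /-- The Jacobi identity, as the equality of the coefficients of `z₀⁻ˡ⁻¹ z₁⁻ᵐ⁻¹ z₂⁻ⁿ⁻¹` of both
  sides of
  `z₀⁻¹δ((z₁-z₂)/z₀) Y(u,z₁)Y(v,z₂)w - z₀⁻¹δ((-z₂+z₁)/z₀) Y(v,z₂)Y(u,z₁)w`
  `= z₁⁻¹δ((z₂+z₀)/z₁) Y(Y(u,z₀)v,z₂)w`.
  All three sums are finite, by truncation. -/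
  jacobi : ∀ (l m n : ℤ) (u v w : V),
    (∑ᶠ i : ℕ, ((-1 : ℂ) ^ i * (Ring.choose l i : ℤ)) •
        toVOAData.mode (m + l - i) u (toVOAData.mode (n + i) v w)) -
      (∑ᶠ i : ℕ, ((-1 : ℂ) ^ (l - i) * (Ring.choose l i : ℤ)) •
        toVOAData.mode (n + l - i) v (toVOAData.mode (m + i) u w)) =
    ∑ᶠ i : ℕ, ((Ring.choose m i : ℤ) : ℂ) •
        toVOAData.mode (m + n - i) (toVOAData.mode (l + i) u v) w

namespace VertexOperatorAlgebra

variable {V : Type*} [AddCommGroup V] [Module ℂ V]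

/-- A vertex operator algebra is simple if it is irreducible as a module over itself. -/
def IsSimple (A : VertexOperatorAlgebra V) : Prop :=
  Nontrivial V ∧ ∀ W : Submodule ℂ V,
    (∀ (u : V) (n : ℤ), ∀ w ∈ W, A.mode n u w ∈ W) → W = ⊥ ∨ W = ⊤

section HopfAction

variable {H : Type*} [Ring H] [HopfAlgebra ℂ H] [Module H V] [IsScalarTower ℂ H V]

/-- The linear map `H ⊗ H → V`, `g ⊗ h ↦ (g u)ₙ (h v)`. -/
def tensorMode (A : VertexOperatorAlgebra V) (n : ℤ) (u v : V) : H ⊗[ℂ] H →ₗ[ℂ] V :=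
  TensorProduct.lift ((A.mode n).compl₁₂
    ((LinearMap.toSpanSingleton H V u).restrictScalars ℂ)
    ((LinearMap.toSpanSingleton H V v).restrictScalars ℂ))

theorem tensorMode_tmul (A : VertexOperatorAlgebra V) (n : ℤ) (u v : V) (g h : H) :
    A.tensorMode n u v (g ⊗ₜ[ℂ] h) = A.mode n (g • u) (h • v) := by
  simp [tensorMode]

variable (H) in
/-- The `H`-module `V` is an `H`-module vertex operator algebra: `h ω = ε(h) ω` and
`h (Y(u, z) v) = ∑ Y(h₁ u, z) (h₂ v)`, where `Δ(h) = ∑ h₁ ⊗ h₂`. -/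
structure IsHopfModule (A : VertexOperatorAlgebra V) : Prop where
  smul_conformal : ∀ h : H, h • A.conformal = Coalgebra.counit (R := ℂ) h • A.conformal
  smul_mode : ∀ (h : H) (n : ℤ) (u v : V),
    h • A.mode n u v = A.tensorMode n u v (Coalgebra.comul (R := ℂ) h)

end HopfAction

end VertexOperatorAlgebra

/-- A left `H`-module `M` is inner faithful if `I M ≠ 0` for every nonzero Hopf ideal `I`
(a two-sided ideal that is a coideal and is stable under the antipode). -/
def IsInnerFaithful (H M : Type*) [Ring H] [HopfAlgebra ℂ H] [AddCommGroup M] [Module H M] :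
    Prop :=
  ∀ I : Ideal H, I.IsTwoSided → I.IsHopfIdeal ℂ → I ≠ ⊥ → ∃ h ∈ I, ∃ m : M, h • m ≠ 0

/-- `H` is isomorphic to a group algebra `ℂ[G]` with its standard Hopf algebra structure
`Δ(g) = g ⊗ g`, `ε(g) = 1`, `S(g) = g⁻¹` (an isomorphism of bialgebras between Hopf algebras
automatically commutes with the antipodes). -/
def IsGroupAlgebra.{u} (H : Type u) [Ring H] [HopfAlgebra ℂ H] : Prop :=
  ∃ (G : Type u) (_ : Group G), Nonempty (MonoidAlgebra ℂ G ≃ₐc[ℂ] H)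

end

/-! In a simple VOA the map `u ⊗ v ↦ Y(u, z) v` is injective on `V ⊗ V` (`IsSimple.modeKer_eq_bot`),
so identities between the modes of tensors lift to identities in `V ⊗ V`, and then to `H ⊗ H` modulo
what acts by zero.

This is used twice. If `h` kills `V`, then `∑ Y(h₁u, z) h₂v = 0` forces `Δ(h)` to die in `H/K ⊗
H/K`; so `K` is a biideal, and finite dimension makes it a Hopf ideal. Inner faithfulness then gives
`K = 0`. Secondly, skew-symmetry shows that `Δ(h)` and its flip have the same modes, so a faithful
`H` is cocommutative.

A finite-dimensional cocommutative Hopf algebra over `ℂ` is a group algebra: its dual is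
commutative, the maximal ideals of the dual are the group-like elements, and the absence of
primitive elements makes the dual reduced, so that group-likes span. -/

open scoped TensorProduct

noncomputable section

/-! ### Joint injectivity on tensor products -/

/-- Jointly injective linear maps stay jointly injective after tensoring with a vector space. -/
theorem TensorProduct.eq_zero_of_forall_rTensor_eq_zero {k M N ι : Type*} {P : ι → Type*} [Field k]
    [AddCommGroup M] [Module k M] [AddCommGroup N] [Module k N] [∀ i, AddCommGroup (P i)]
    [∀ i, Module k (P i)] (f : ∀ i, M →ₗ[k] P i) (hf : ∀ m, (∀ i, f i m = 0) → m = 0)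
    (t : M ⊗[k] N) (ht : ∀ i, (f i).rTensor N t = 0) : t = 0 := by
  classical
  let b := Module.Basis.ofVectorSpace k N
  have key : ∀ i (s : M ⊗[k] N) j, TensorProduct.equivFinsuppOfBasisRight b ((f i).rTensor N s) j =
      f i (TensorProduct.equivFinsuppOfBasisRight b s j) := by
    intro i s j
    induction s using TensorProduct.induction_on with
    | zero => simp
    | tmul m n => simp
    | add x y hx hy => simp [hx, hy]
  apply (TensorProduct.equivFinsuppOfBasisRight b).injective
  ext j
  rw [map_zero, Finsupp.zero_apply]
  refine hf _ fun i => ?_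
  rw [← key, ht i]
  simp

theorem TensorProduct.eq_zero_of_forall_lTensor_eq_zero {k M N ι : Type*} {P : ι → Type*} [Field k]
    [AddCommGroup M] [Module k M] [AddCommGroup N] [Module k N] [∀ i, AddCommGroup (P i)]
    [∀ i, Module k (P i)] (f : ∀ i, M →ₗ[k] P i) (hf : ∀ m, (∀ i, f i m = 0) → m = 0)
    (t : N ⊗[k] M) (ht : ∀ i, (f i).lTensor N t = 0) : t = 0 := by
  apply (TensorProduct.comm k N M).injective
  rw [map_zero]
  refine eq_zero_of_forall_rTensor_eq_zero f hf _ fun i => ?_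
  have : (f i).rTensor N (TensorProduct.comm k N M t) =
      TensorProduct.comm k N (P i) ((f i).lTensor N t) := by
    rw [← LinearMap.comm_comp_lTensor_comp_comm_eq]
    simp
  rw [this, ht i, map_zero]

theorem TensorProduct.eq_zero_of_forall_map_eq_zero {k M N ι κ : Type*} {P : ι → Type*}
    {Q : κ → Type*} [Field k]
    [AddCommGroup M] [Module k M] [AddCommGroup N] [Module k N] [∀ i, AddCommGroup (P i)]
    [∀ i, Module k (P i)] [∀ i, AddCommGroup (Q i)] [∀ i, Module k (Q i)]
    (f : ∀ i, M →ₗ[k] P i) (hf : ∀ m, (∀ i, f i m = 0) → m = 0)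
    (g : ∀ i, N →ₗ[k] Q i) (hg : ∀ n, (∀ i, g i n = 0) → n = 0)
    (t : M ⊗[k] N) (ht : ∀ i j, TensorProduct.map (f i) (g j) t = 0) : t = 0 := by
  refine eq_zero_of_forall_rTensor_eq_zero f hf _ fun i => ?_
  refine eq_zero_of_forall_lTensor_eq_zero g hg _ fun j => ?_
  rw [← LinearMap.comp_apply, LinearMap.lTensor_comp_rTensor, ht]

/-! ### Injectivity of `u ⊗ v ↦ Y(u, z) v`, and skew-symmetry -/

namespace VertexOperatorAlgebra

variable {V : Type*} [AddCommGroup V] [Module ℂ V] (A : VertexOperatorAlgebra V)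

theorem exists_mode_eq_zero (u v : V) : ∃ N : ℕ, ∀ n : ℤ, N ≤ n → A.mode n u v = 0 := by
  refine ⟨(-((HahnModule.of ℂ).symm (A.Y u v)).order).toNat, fun n hn => ?_⟩
  rw [VOAData.mode_apply]
  apply VertexOperator.ncoeff_eq_zero_of_lt_order
  have := Int.self_le_toNat (-((HahnModule.of ℂ).symm (A.Y u v)).order)
  omega

/-- The linear map `u ⊗ v ↦ uₙ v`. -/
def modeTensor (n : ℤ) : V ⊗[ℂ] V →ₗ[ℂ] V := TensorProduct.lift (A.mode n)

@[simp]
theorem modeTensor_tmul (n : ℤ) (u v : V) : A.modeTensor n (u ⊗ₜ v) = A.mode n u v := by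
  simp [modeTensor]

theorem exists_modeTensor_eq_zero (t : V ⊗[ℂ] V) :
    ∃ N : ℕ, ∀ n : ℤ, N ≤ n → A.modeTensor n t = 0 := by
  induction t using TensorProduct.induction_on with
  | zero => exact ⟨0, by simp⟩
  | tmul u v => simpa using A.exists_mode_eq_zero u v
  | add x y hx hy =>
    obtain ⟨M, hM⟩ := hx
    obtain ⟨N, hN⟩ := hy
    refine ⟨max M N, fun n hn => ?_⟩
    rw [map_add, hM n (by push_cast at hn; omega), hN n (by push_cast at hn; omega), add_zero]

/-- Locality, for `∑ Y(uᵢ, z₂) vᵢ` in place of a single product. -/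
theorem exists_locality (w : V) (t : V ⊗[ℂ] V) : ∃ N₀ : ℕ, ∀ N : ℕ, N₀ ≤ N → ∀ m n : ℤ,
    (∑ i ∈ Finset.range (N + 1), ((-1 : ℂ) ^ i * (N.choose i : ℂ)) •
        A.mode (m + N - i) w (A.modeTensor (n + i) t)) =
      ∑ i ∈ Finset.range (N + 1), ((-1 : ℂ) ^ ((N : ℤ) - i) * (N.choose i : ℂ)) •
        A.modeTensor (n + N - i) ((A.mode (m + i) w).lTensor V t) := by
  induction t using TensorProduct.induction_on with
  | zero => exact ⟨0, by simp⟩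
  | tmul u v =>
    obtain ⟨N₀, hN₀⟩ := A.exists_mode_eq_zero w u
    refine ⟨N₀, fun N hN m n => ?_⟩
    -- With `l = N` so large that `w_{N+i} u = 0` for all `i`, the iterate side vanishes and the
    -- binomial sums stop at `N`.
    have hJ := A.jacobi N m n w u v
    rw [finsum_eq_sum_of_support_subset (s := Finset.range (N + 1)),
      finsum_eq_sum_of_support_subset (s := Finset.range (N + 1)), finsum_eq_zero_of_forall_eq_zero,
      sub_eq_zero] at hJ
    · simpa [Ring.choose_natCast] using hJ
    · intro i
      rw [hN₀ (N + i) (by omega)]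
      simp
    all_goals
    · intro i hi
      by_contra h
      apply hi
      have : N < i := by simpa using h
      simp [Ring.choose_natCast, Nat.choose_eq_zero_of_lt this]
  | add x y hx hy =>
    obtain ⟨N₁, h₁⟩ := hx
    obtain ⟨N₂, h₂⟩ := hy
    refine ⟨max N₁ N₂, fun N hN m n => ?_⟩
    simp only [map_add, smul_add, Finset.sum_add_distrib]
    rw [h₁ N (by omega), h₂ N (by omega)]

theorem exists_lTensor_mode_eq_zero (w : V) (t : V ⊗[ℂ] V) :
    ∃ M : ℤ, ∀ m : ℤ, M ≤ m → (A.mode m w).lTensor V t = 0 := by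
  induction t using TensorProduct.induction_on with
  | zero => exact ⟨0, by simp⟩
  | tmul u v =>
    obtain ⟨N, hN⟩ := A.exists_mode_eq_zero w v
    exact ⟨N, fun m hm => by simp [hN m hm]⟩
  | add x y hx hy =>
    obtain ⟨M, hM⟩ := hx
    obtain ⟨N, hN⟩ := hy
    exact ⟨max M N, fun n hn => by rw [map_add, hM n (by omega), hN n (by omega), add_zero]⟩

/-- The tensors `∑ uᵢ ⊗ vᵢ` such that `∑ Y(uᵢ, z) vᵢ = 0`. -/
def modeKer : Submodule ℂ (V ⊗[ℂ] V) := ⨅ n, LinearMap.ker (A.modeTensor n)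

theorem mem_modeKer {t : V ⊗[ℂ] V} : t ∈ A.modeKer ↔ ∀ n, A.modeTensor n t = 0 := by
  simp [modeKer]

/-- Descending induction on `m`: truncation settles large `m`. In the locality relation the side
where `w` acts outside vanishes because `t` is in the kernel, and the terms with `w_{m+i}`, `i ≥ 1`,
vanish by induction; only `i = 0` remains. -/
theorem lTensor_mode_mem_modeKer (w : V) (m : ℤ) {t : V ⊗[ℂ] V} (ht : t ∈ A.modeKer) :
    (A.mode m w).lTensor V t ∈ A.modeKer := by
  rw [mem_modeKer] at ht
  obtain ⟨N, hN⟩ := A.exists_locality w t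
  obtain ⟨M, hM⟩ := A.exists_lTensor_mode_eq_zero w t
  have key : ∀ k : ℕ, ∀ m : ℤ, M ≤ m + k → ∀ n, A.modeTensor n ((A.mode m w).lTensor V t) = 0 := by
    intro k
    induction k with
    | zero => intro m hm n; rw [hM m (by simpa using hm), map_zero]
    | succ k ih =>
      intro m hm n
      have h := hN N le_rfl m (n - N)
      rw [Finset.sum_eq_zero fun i _ => by rw [ht, map_zero, smul_zero],
        Finset.sum_range_succ', Finset.sum_eq_zero, zero_add] at h
      · have h' := h.symm
        simpa [smul_eq_zero] using h'
      · intro i _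
        rw [ih _ (by push_cast at hm ⊢; omega), smul_zero]
  exact A.mem_modeKer.2 (key (M - m).toNat m (by have := Int.self_le_toNat (M - m); omega))

/-- The associative algebra generated by all modes `uₙ`. -/
def modeAlgebra : Subalgebra ℂ (Module.End ℂ V) :=
  Algebra.adjoin ℂ (Set.range fun p : V × ℤ => A.mode p.2 p.1)

theorem mode_mem_modeAlgebra (n : ℤ) (u : V) : A.mode n u ∈ A.modeAlgebra :=
  Algebra.subset_adjoin ⟨(u, n), rfl⟩

theorem lTensor_mem_modeKer {r : Module.End ℂ V} (hr : r ∈ A.modeAlgebra) {t : V ⊗[ℂ] V}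
    (ht : t ∈ A.modeKer) : r.lTensor V t ∈ A.modeKer := by
  induction hr using Algebra.adjoin_induction generalizing t with
  | mem x hx =>
    obtain ⟨p, rfl⟩ := hx
    exact A.lTensor_mode_mem_modeKer _ _ ht
  | algebraMap c =>
    rw [Module.algebraMap_end_eq_smul_id, LinearMap.lTensor_smul, LinearMap.lTensor_id]
    exact Submodule.smul_mem _ _ ht
  | add x y _ _ hx hy =>
    rw [LinearMap.lTensor_add]
    exact Submodule.add_mem _ (hx ht) (hy ht)
  | mul x y _ _ hx hy =>
    rw [LinearMap.lTensor_mul]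
    exact hx (hy ht)

variable {A}

theorem IsSimple.isSimpleModule (hA : A.IsSimple) : IsSimpleModule A.modeAlgebra V := by
  have := hA.1
  refine { eq_bot_or_eq_top := fun W => ?_ }
  have h := hA.2 (W.restrictScalars ℂ) fun u n w hw =>
    W.smul_mem ⟨_, A.mode_mem_modeAlgebra n u⟩ hw
  simpa using h

/-- Schur's lemma for simple vertex operator algebras. -/
theorem IsSimple.exists_eq_smul (hA : A.IsSimple) (φ : Module.End A.modeAlgebra V) :
    ∃ c : ℂ, ∀ v, φ v = c • v := by
  have hmode : ∀ (n : ℤ) (u v : V), φ (A.mode n u v) = A.mode n u (φ v) := fun n u v =>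
    φ.map_smul ⟨_, A.mode_mem_modeAlgebra n u⟩ v
  have := hA.1
  obtain ⟨n, hn⟩ : ∃ n, A.grade n ≠ ⊥ := by
    by_contra! h
    exact bot_ne_top ((iSup_eq_bot.2 h).symm.trans A.isInternal_grade.submodule_iSup_eq_top)
  have := A.finite_grade n
  have := Submodule.nontrivial_iff_ne_bot.2 hn
  let φ' : Module.End ℂ V := φ.restrictScalars ℂ
  -- `φ` commutes with `L(0)`, hence preserves the finite-dimensional weight space, where an
  -- eigenvalue exists.
  have hφ : ∀ v ∈ A.grade n, φ' v ∈ A.grade n := by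
    intro v hv
    rw [A.mem_grade_iff] at hv ⊢
    rw [VOAData.L] at hv ⊢
    change A.mode _ _ (φ v) = _
    rw [← hmode, hv]
    exact φ'.map_smul _ _
  obtain ⟨c, hc⟩ := Module.End.exists_eigenvalue (φ'.restrict hφ)
  obtain ⟨v, hv⟩ := hc.exists_hasEigenvector
  refine ⟨c, fun w => ?_⟩
  have h := hA.2 (LinearMap.ker (φ' - c • LinearMap.id)) fun u m w hw => by
    have hw' : φ w = c • w := by simpa [φ', sub_eq_zero] using hw
    simp [φ', hmode, hw']
  have hv' : (v : V) ∈ LinearMap.ker (φ' - c • LinearMap.id) := by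
    have := congrArg Subtype.val hv.apply_eq_smul
    simpa [sub_eq_zero] using this
  rcases h with h | h
  · exact absurd (Subtype.ext (by simpa [h] using hv')) hv.2
  · have : w ∈ LinearMap.ker (φ' - c • LinearMap.id) := h ▸ Submodule.mem_top
    simpa [φ', sub_eq_zero] using this

theorem IsSimple.exists_modeAlgebra_apply_eq (hA : A.IsSimple) (f : Module.End ℂ V)
    (s : Finset V) : ∃ r ∈ A.modeAlgebra, ∀ v ∈ s, f v = r v := by
  have := hA.isSimpleModule
  -- By Schur the commutant is `ℂ`, so every `ℂ`-linear map qualifies for the density theorem.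
  let f' : Module.End (Module.End A.modeAlgebra V) V :=
    { toFun := f
      map_add' := f.map_add
      map_smul' := fun φ v => by
        obtain ⟨c, hc⟩ := hA.exists_eq_smul φ
        simp [hc] }
  obtain ⟨r, hr⟩ := jacobson_density f' s
  exact ⟨r, r.2, hr⟩

/-- In a simple vertex operator algebra, `∑ Y(uᵢ, z) vᵢ = 0` only if `∑ uᵢ ⊗ vᵢ = 0`. -/
theorem IsSimple.modeKer_eq_bot (hA : A.IsSimple) : A.modeKer = ⊥ := by
  classical
  rw [eq_bot_iff]
  intro t ht
  let b := Module.Basis.ofVectorSpace ℂ V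
  let e := TensorProduct.equivFinsuppOfBasisRight (R := ℂ) (M := V) b
  rw [Submodule.mem_bot]
  apply e.injective
  rw [map_zero]
  ext j
  -- `r` sends `b j` to the vacuum and kills the other basis vectors occurring in `t`. Then `1 ⊗ r`
  -- isolates the `j`-th coefficient `m` of `t` as `m ⊗ 𝟏`, and `m₋₁𝟏 = m` must vanish.
  obtain ⟨r, hr, hrv⟩ := hA.exists_modeAlgebra_apply_eq
    ((b.coord j).smulRight A.vacuum) ((e t).support.image b)
  have h := A.mem_modeKer.1 (A.lTensor_mem_modeKer hr ht) (-1)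
  have ht' : t = (e t).sum fun i m => m ⊗ₜ b i := by
    conv_lhs => rw [← e.symm_apply_apply t]
    exact TensorProduct.equivFinsuppOfBasisRight_symm_apply b _
  have h2 : r.lTensor V t = (e t j) ⊗ₜ A.vacuum := by
    conv_lhs => rw [ht']
    rw [Finsupp.sum, map_sum]
    have : ∀ i ∈ (e t).support, r.lTensor V ((e t i) ⊗ₜ b i) =
        if i = j then (e t j) ⊗ₜ A.vacuum else 0 := by
      intro i hi
      rw [LinearMap.lTensor_tmul, ← hrv _ (Finset.mem_image_of_mem _ hi)]
      by_cases hij : i = j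
      · subst hij; simp
      · simp [hij]
    rw [Finset.sum_congr rfl this]
    simp +contextual
  rw [h2, modeTensor_tmul, A.mode_vacuum] at h
  simpa using h

variable (A)

/-- Skew-symmetry. -/
theorem mode_eq_finsum_mode_vacuum (l : ℤ) (u v : V) : A.mode l v u =
    ∑ᶠ i : ℕ, ((-1 : ℂ) ^ (l + i + 1)) • A.mode (-1 - i) (A.mode (l + i) u v) A.vacuum := by
  -- Since `v_i 𝟏 = 0` for `i ≥ 0`, the first sum vanishes and the second keeps only `u₋₁𝟏 = u`.
  have hJ := A.jacobi l (-1) 0 u v A.vacuum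
  rw [finsum_eq_zero_of_forall_eq_zero, finsum_eq_single _ 0, zero_sub] at hJ
  · have h0 : A.mode (-1 + (0 : ℕ)) u A.vacuum = u := by simpa using A.mode_vacuum u
    rw [h0] at hJ
    have hl : ((-1 : ℂ) ^ (l + 1)) * (-1 : ℂ) ^ l = -1 := by
      rw [← zpow_add₀ (by norm_num), show l + 1 + l = 2 * l + 1 by ring,
        zpow_add₀ (by norm_num), zpow_mul]
      norm_num
    have := congrArg (fun x => (-1 : ℂ) ^ (l + 1) • x) hJ
    simp only [smul_neg, smul_smul, Ring.choose_zero_right, smul_finsum] at this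
    simp only [Nat.cast_zero, sub_zero, zero_add, Int.cast_one, mul_one, hl, neg_smul, one_smul,
      neg_neg] at this
    rw [this]
    refine finsum_congr fun i => ?_
    congr 1
    · rw [show l + i + 1 = l + 1 + i by ring, zpow_add₀ (by norm_num) (l + 1) (i : ℤ),
        Ring.choose_neg, add_sub_cancel_left, Ring.choose_natCast]
      simp [Int.negOnePow_def, Units.smul_def]
  · intro i hi
    rw [A.mode_vacuum_of_nonneg _ _ (by omega)]
    simp
  · intro i
    rw [A.mode_vacuum_of_nonneg _ _ (by omega)]
    simp

end VertexOperatorAlgebra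

/-! ### Biideals and the antipode -/

section Antipode

variable {k H : Type*} [Field k] [Ring H] [HopfAlgebra k H]

open WithConv in
/-- The antipode descends along surjections onto finite-dimensional bialgebras. -/
theorem BialgHom.exists_comp_eq_comp_antipode {Q : Type*} [Ring Q] [Bialgebra k Q]
    [Module.Finite k Q] (π : H →ₐc[k] Q) (hπ : Function.Surjective π) :
    ∃ s : Q →ₗ[k] Q, ∀ h, s (π h) = π (HopfAlgebra.antipode k h) := by
  -- Pullback along `π` is an injective unital map of convolution algebras taking `id` to `π`, which
  -- has left inverse `π ∘ S`. So convolution by `id` is injective on `End Q`, hence surjective by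
  -- finite dimension; the resulting right inverse of `id` pulls back to `π ∘ S`.
  let j : WithConv (Q →ₗ[k] Q) → WithConv (H →ₗ[k] Q) :=
    fun f => toConv (f.ofConv ∘ₗ π.toCoalgHom.toLinearMap)
  have hjmul : ∀ f g, j (f * g) = j f * j g := fun f g =>
    WithConv.ofConv_injective (LinearMap.convMul_comp_coalgHom_distrib f g π.toCoalgHom)
  have hjinj : ∀ f, j f = 0 → f = 0 := by
    intro f hf
    ext q
    obtain ⟨h, rfl⟩ := hπ q
    exact congr($hf h)
  have hjone : j 1 = 1 := by
    ext h
    exact congrArg (algebraMap k Q) (CoalgHomClass.counit_comp_apply π h)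
  let u : WithConv (H →ₗ[k] Q) := toConv (π : H →ₐ[k] Q).toLinearMap
  let v : WithConv (H →ₗ[k] Q) :=
    toConv ((π : H →ₐ[k] Q).toLinearMap ∘ₗ HopfAlgebra.antipode k)
  have hvu : v * u = 1 := by
    have := LinearMap.algHom_comp_convMul_distrib (π : H →ₐ[k] Q)
      (toConv (HopfAlgebra.antipode k)) (toConv LinearMap.id)
    rw [LinearMap.antipode_mul_id] at this
    apply WithConv.ofConv_injective
    refine this.symm.trans ?_
    ext h
    exact AlgHomClass.commutes π _
  let e : WithConv (Q →ₗ[k] Q) := toConv LinearMap.id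
  have hje : j e = u := rfl
  have : Module.Finite k (WithConv (Q →ₗ[k] Q)) :=
    Module.Finite.equiv (WithConv.linearEquiv k (Q →ₗ[k] Q)).symm
  have hinj : Function.Injective (LinearMap.mulLeft k e) := by
    rw [← LinearMap.ker_eq_bot, LinearMap.ker_eq_bot']
    intro f hf
    apply hjinj
    have h1 : u * j f = 0 := by
      rw [LinearMap.mulLeft_apply] at hf
      rw [← hje, ← hjmul, hf]
      rfl
    rw [← one_mul (j f), ← hvu, mul_assoc, h1, mul_zero]
  obtain ⟨s, hs⟩ := LinearMap.injective_iff_surjective.1 hinj 1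
  rw [LinearMap.mulLeft_apply] at hs
  have hv : v = j s := left_inv_eq_right_inv hvu (by rw [← hje, ← hjmul, hs, hjone])
  exact ⟨s.ofConv, fun h => (congr($hv h)).symm⟩

/-- Biideals of finite-dimensional Hopf algebras are Hopf ideals. -/
theorem Ideal.IsHopfIdeal.of_isCoideal [Module.Finite k H] (I : Ideal H) [I.IsTwoSided]
    [(I.restrictScalars k).IsCoideal] : I.IsHopfIdeal k where
  antipode_mem x hx := by
    obtain ⟨s, hs⟩ := BialgHom.exists_comp_eq_comp_antipode
      (Bialgebra.Quotient.mkBialgHom (R := k) I) Ideal.Quotient.mk_surjective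
    have h := hs x
    rw [Bialgebra.Quotient.mkBialgHom_apply, Ideal.Quotient.eq_zero_iff_mem.2 hx, map_zero] at h
    exact Ideal.Quotient.eq_zero_iff_mem.1 h.symm

end Antipode

/-! ### Primitive elements in characteristic zero -/

section Primitive

variable {k H : Type*} [Field k] [CharZero k] [Ring H] [Bialgebra k H] [Module.Finite k H]

/-- For a functional `φ` with `φ 1 = 0` and `φ x = 1`, the operator `T = (id ⊗ φ)Δ` acts like
differentiation: `T(xⁿ)` is `n xⁿ⁻¹` plus lower powers. Hence a relation expressing a power of `x`
by lower ones descends to `1 = 0`, and the powers of a nonzero `x` would be independent. -/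
theorem eq_zero_of_comul_eq_add {x : H}
    (hx : Coalgebra.comul (R := k) x = x ⊗ₜ 1 + 1 ⊗ₜ x) : x = 0 := by
  by_contra hne
  have hε : Coalgebra.counit (R := k) x = 0 := by
    have h := Coalgebra.rTensor_counit_comul (R := k) x
    rw [hx] at h
    have h' := congrArg (TensorProduct.lid k H) h
    simp only [map_add, LinearMap.rTensor_tmul, TensorProduct.lid_tmul, Bialgebra.counit_one,
      add_eq_right, Algebra.smul_def, mul_one] at h'
    have := congrArg (Coalgebra.counit (R := k)) h'
    simpa using this
  have h1 : x ∉ Submodule.span k {(1 : H)} := by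
    rw [Submodule.mem_span_singleton]
    rintro ⟨c, rfl⟩
    simp at hε
    simp [hε] at hne
  obtain ⟨φ₀, hφx, hφ1⟩ := Submodule.exists_le_ker_of_notMem h1
  let φ : H →ₗ[k] k := (φ₀ x)⁻¹ • φ₀
  have hφ1 : φ 1 = 0 := by
    have : φ₀ 1 = 0 := hφ1 (Submodule.mem_span_singleton_self _)
    simp [φ, this]
  have hφx : φ x = 1 := by simp [φ, hφx]
  let T : H →ₗ[k] H := TensorProduct.rid k H ∘ₗ φ.lTensor H ∘ₗ Coalgebra.comul
  have hT : ∀ n, T (x ^ n) = ∑ i ∈ Finset.range (n + 1), ((n.choose i : k) * φ (x ^ (n - i))) • x ^ i := by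
    intro n
    have hc : Commute (x ⊗ₜ[k] (1 : H)) ((1 : H) ⊗ₜ[k] x) := by
      simp [Commute, SemiconjBy]
    have : Coalgebra.comul (R := k) (x ^ n) = ∑ i ∈ Finset.range (n + 1),
        (n.choose i : k) • (x ^ i) ⊗ₜ[k] (x ^ (n - i)) := by
      rw [Bialgebra.comul_pow, hx, hc.add_pow]
      refine Finset.sum_congr rfl fun i _ => ?_
      rw [Algebra.TensorProduct.tmul_pow, Algebra.TensorProduct.tmul_pow,
        Algebra.TensorProduct.tmul_mul_tmul, ← nsmul_eq_mul', Nat.cast_smul_eq_nsmul]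
      simp
    simp [T, this, mul_smul]
  let W : ℕ →o Submodule k H :=
    ⟨fun n => Submodule.span k ((fun i => x ^ i) '' Set.Iio n), fun m n hmn =>
      Submodule.span_mono (Set.image_mono (Set.Iio_subset_Iio hmn))⟩
  have hW : ∀ {i n}, i < n → x ^ i ∈ W n := fun h =>
    Submodule.subset_span ⟨_, h, rfl⟩
  have hTn : ∀ n, T (x ^ (n + 1)) - ((n + 1 : ℕ) : k) • x ^ n ∈ W n := by
    intro n
    rw [hT, Finset.sum_range_succ, Finset.sum_range_succ]
    have e : n + 1 - n = 1 := by omega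
    simp only [Nat.sub_self, pow_zero, hφ1, mul_zero, zero_smul, add_zero, e, pow_one, hφx, mul_one,
      Nat.choose_succ_self_right, add_sub_cancel_right]
    exact Submodule.sum_mem _ fun i hi => Submodule.smul_mem _ _ (hW (Finset.mem_range.1 hi))
  have hTW : ∀ n, ∀ y ∈ W (n + 1), T y ∈ W n := by
    intro n y hy
    induction hy using Submodule.span_induction with
    | mem y hy =>
      obtain ⟨i, hi, rfl⟩ := hy
      have hi : i < n + 1 := hi
      cases i with
      | zero =>
        have h0 : T (x ^ 0) = 0 := by rw [hT]; simp [hφ1]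
        change T (x ^ 0) ∈ W n
        rw [h0]
        exact Submodule.zero_mem _
      | succ i =>
        have h2 := W.monotone (show i ≤ n by omega) (hTn i)
        have h3 := Submodule.add_mem _ h2
          (Submodule.smul_mem _ ((i + 1 : ℕ) : k) (hW (show i < n by omega)))
        simpa using h3
    | zero => simp
    | add y z _ _ hy hz => rw [map_add]; exact Submodule.add_mem _ hy hz
    | smul c y _ hy => rw [map_smul]; exact Submodule.smul_mem _ _ hy
  have hnot : ∀ n, x ^ n ∉ W n := by
    intro n
    induction n with
    | zero =>
      have : Nontrivial H := ⟨x, 0, hne⟩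
      have hW0 : W 0 = ⊥ := by
        change Submodule.span k ((fun i => x ^ i) '' Set.Iio 0) = ⊥
        simp
      simp [hW0]
    | succ n ih =>
      intro hmem
      apply ih
      have h2 := Submodule.sub_mem _ (hTW _ _ hmem) (hTn n)
      rw [sub_sub_cancel] at h2
      exact (Submodule.smul_mem_iff _ (Nat.cast_ne_zero.2 n.succ_ne_zero)).1 h2
  obtain ⟨n, hn⟩ := monotone_stabilizes_iff_noetherian.2 (inferInstance : IsNoetherian k H) W
  apply hnot n
  rw [hn (n + 1) n.le_succ]
  exact hW n.lt_succ_self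

end Primitive

/-! ### Cocommutative Hopf algebras through their duals -/

section Dual

variable {k H : Type*} [Field k]

open WithConv

theorem TensorProduct.eq_of_forall_dual {M N : Type*} [AddCommGroup M] [Module k M]
    [AddCommGroup N] [Module k N] {s t : M ⊗[k] N}
    (h : ∀ (f : M →ₗ[k] k) (g : N →ₗ[k] k), LinearMap.mul' k k (TensorProduct.map f g s) =
      LinearMap.mul' k k (TensorProduct.map f g t)) : s = t := by
  refine sub_eq_zero.1 (eq_zero_of_forall_map_eq_zero
    (fun f : M →ₗ[k] k => f) (fun m => (Module.forall_dual_apply_eq_zero_iff k m).1)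
    (fun f : N →ₗ[k] k => f) (fun m => (Module.forall_dual_apply_eq_zero_iff k m).1) _ fun f g => ?_)
  have hinj : Function.Injective (LinearMap.mul' k k) := (TensorProduct.lid k k).injective
  apply hinj
  rw [map_sub, map_sub, h, sub_self, map_zero]

variable [Ring H] [HopfAlgebra k H] [Module.Finite k H]

instance : Module.Finite k (WithConv (H →ₗ[k] k)) :=
  Module.Finite.equiv (WithConv.linearEquiv k (H →ₗ[k] k)).symm

theorem exists_forall_eq_apply (χ : WithConv (H →ₗ[k] k) →ₗ[k] k) : ∃ x : H, ∀ f, χ f = f x := by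
  obtain ⟨x, hx⟩ := (Module.evalEquiv k H).surjective
    (χ ∘ₗ (WithConv.linearEquiv k (H →ₗ[k] k)).symm.toLinearMap)
  refine ⟨x, fun f => ?_⟩
  exact (LinearMap.congr_fun hx f.ofConv).symm

variable [IsAlgClosed k] [Coalgebra.IsCocomm k H]

/-- The maximal ideals of the dual of a finite-dimensional cocommutative Hopf algebra are given by
the group-like elements. -/
theorem exists_isGroupLikeElem_of_isMaximal (M : Ideal (WithConv (H →ₗ[k] k))) [M.IsMaximal] :
    ∃ g : H, IsGroupLikeElem k g ∧ ∀ f, f ∈ M ↔ f g = 0 := by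
  let : Field (WithConv (H →ₗ[k] k) ⧸ M) := Ideal.Quotient.field M
  -- The residue field is finite over the algebraically closed `k`, so `M` is the kernel of a
  -- character. By reflexivity it is evaluation at some `g`, and multiplicativity says `Δ(g) = g ⊗
  -- g`.
  let e : k ≃ₐ[k] (WithConv (H →ₗ[k] k) ⧸ M) := AlgEquiv.ofBijective (Algebra.ofId _ _)
    IsAlgClosed.algebraMap_bijective_of_isIntegral
  let χ : WithConv (H →ₗ[k] k) →ₐ[k] k := e.symm.toAlgHom.comp (Ideal.Quotient.mkₐ k M)
  obtain ⟨g, hg⟩ := exists_forall_eq_apply χ.toLinearMap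
  have hg : ∀ f, χ f = f g := hg
  refine ⟨g, ⟨?_, ?_⟩, fun f => ?_⟩
  · have := hg 1
    rw [map_one] at this
    exact this.symm
  · refine TensorProduct.eq_of_forall_dual fun f f' => ?_
    have := hg (toConv f * toConv f')
    rw [map_mul, hg, hg] at this
    simpa using this.symm
  · rw [← hg, ← Ideal.Quotient.eq_zero_iff_mem]
    exact (map_eq_zero_iff e.symm e.symm.injective).symm

variable [CharZero k]

/-- A nonzero functional on `M/M²` would be a point derivation at `g`, that is, evaluation at some
`x` with `Δ(x) = g ⊗ x + x ⊗ g`. Then `g⁻¹x` is primitive, so zero. -/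
theorem isIdempotentElem_of_isMaximal (M : Ideal (WithConv (H →ₗ[k] k))) [M.IsMaximal] :
    IsIdempotentElem M := by
  obtain ⟨g, hg, hM⟩ := exists_isGroupLikeElem_of_isMaximal M
  refine le_antisymm Ideal.mul_le_left fun f hf => ?_
  by_contra hf2
  obtain ⟨l, hlf, hl⟩ := Submodule.exists_le_ker_of_notMem (K := k)
    (p := (M * M).restrictScalars k) hf2
  -- The correction makes `l'` vanish at `1`, as a derivation must, without changing it on `M`.
  let l' : WithConv (H →ₗ[k] k) →ₗ[k] k :=
    l - l 1 • ((LinearMap.applyₗ g) ∘ₗ (WithConv.linearEquiv k (H →ₗ[k] k)).toLinearMap)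
  have hl' : ∀ a, l' a = l a - l 1 * a g := fun a => rfl
  have hmul : ∀ a b : WithConv (H →ₗ[k] k), (a * b) g = a g * b g := fun a b => by
    simp [hg.comul_eq_tmul_self]
  have hone : (1 : WithConv (H →ₗ[k] k)) g = 1 := by simp [hg.counit_eq_one]
  obtain ⟨x, hx⟩ := exists_forall_eq_apply l'
  have hder : ∀ a b, l' (a * b) = a g * l' b + l' a * b g := by
    intro a b
    have ha : ∀ a : WithConv (H →ₗ[k] k), a - a g • 1 ∈ M := fun a => by
      rw [hM]
      change a g - a g * (1 : WithConv (H →ₗ[k] k)) g = 0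
      rw [hone, mul_one, sub_self]
    have h0 : l ((a - a g • 1) * (b - b g • 1)) = 0 := hl (Ideal.mul_mem_mul (ha a) (ha b))
    have h1 : (a - a g • 1) * (b - b g • 1) = a * b - b g • a - a g • b + (a g * b g) • 1 := by
      simp only [Algebra.smul_def, map_mul]
      ring
    rw [h1] at h0
    simp only [map_add, map_sub, map_smul, smul_eq_mul] at h0
    simp only [hl', hmul]
    linear_combination h0
  have hΔ : Coalgebra.comul (R := k) x = g ⊗ₜ x + x ⊗ₜ g := by
    refine TensorProduct.eq_of_forall_dual fun a b => ?_
    have := hder (toConv a) (toConv b)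
    rw [hx, hx, hx] at this
    simpa using this
  have hy : HopfAlgebra.antipode k g * x = 0 := by
    apply eq_zero_of_comul_eq_add (k := k)
    rw [Bialgebra.comul_mul, hΔ, hg.antipode.comul_eq_tmul_self, mul_add]
    simp [hg.antipode_mul_cancel, add_comm]
  have hx0 : x = 0 := by
    rw [← one_mul x, ← hg.mul_antipode_cancel, mul_assoc, hy, mul_zero]
  apply hlf
  have h2 := hl' f
  rw [hx, hx0, (hM f).1 hf] at h2
  simpa using h2.symm

/-- The dual of a finite-dimensional cocommutative Hopf algebra in characteristic zero is
reduced (Cartier). -/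
theorem jacobson_bot_eq_bot_of_isCocomm :
    (⊥ : Ideal (WithConv (H →ₗ[k] k))).jacobson = ⊥ := by
  have hart : IsArtinianRing (WithConv (H →ₗ[k] k)) := IsArtinianRing.of_finite k _
  have hfin : Finite (MaximalSpectrum (WithConv (H →ₗ[k] k))) := inferInstance
  have := Fintype.ofFinite (MaximalSpectrum (WithConv (H →ₗ[k] k)))
  have hJ : (⊥ : Ideal (WithConv (H →ₗ[k] k))).jacobson =
      ∏ M : MaximalSpectrum (WithConv (H →ₗ[k] k)), M.asIdeal := by
    rw [Ideal.prod_eq_iInf_of_pairwise_isCoprime]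
    · refine le_antisymm (le_iInf₂ fun M _ => sInf_le ⟨bot_le, M.isMaximal⟩)
        (le_sInf fun M hM => ?_)
      exact iInf₂_le (⟨M, hM.2⟩ : MaximalSpectrum _) (Finset.mem_univ _)
    · intro M _ N _ hMN
      have := M.isMaximal
      have := N.isMaximal
      exact Ideal.isCoprime_of_isMaximal fun h => hMN (MaximalSpectrum.ext h)
  -- A product of idempotent ideals is idempotent; Nakayama then kills the radical.
  have hidem : IsIdempotentElem (⊥ : Ideal (WithConv (H →ₗ[k] k))).jacobson := by
    rw [hJ, IsIdempotentElem, ← Finset.prod_mul_distrib]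
    refine Finset.prod_congr rfl fun M _ => ?_
    have := M.isMaximal
    exact isIdempotentElem_of_isMaximal M.asIdeal
  exact Submodule.eq_bot_of_le_smul_of_le_jacobson_bot _ _ (IsNoetherian.noetherian _)
    hidem.symm.le le_rfl

/-- A functional vanishing on all group-likes lies in every maximal ideal of the dual, hence in its
zero radical. -/
theorem span_isGroupLikeElem_eq_top : Submodule.span k {g : H | IsGroupLikeElem k g} = ⊤ := by
  by_contra hne
  obtain ⟨f, hf, hker⟩ := Submodule.exists_le_ker_of_lt_top _ (lt_top_iff_ne_top.2 hne)
  have hJ : toConv f ∈ (⊥ : Ideal (WithConv (H →ₗ[k] k))).jacobson := by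
    rw [Ideal.jacobson, Ideal.mem_sInf]
    rintro M ⟨-, hM⟩
    obtain ⟨g, hg, hgM⟩ := exists_isGroupLikeElem_of_isMaximal M
    exact (hgM _).2 (hker (Submodule.subset_span hg))
  rw [jacobson_bot_eq_bot_of_isCocomm, Ideal.mem_bot] at hJ
  exact hf (congrArg WithConv.ofConv hJ)

/-- Finite-dimensional cocommutative Hopf algebras over an algebraically closed field of
characteristic zero are group algebras. -/
theorem bijective_liftGroupLikeBialgHom :
    Function.Bijective (MonoidAlgebra.liftGroupLikeBialgHom (R := k) (A := H)) := by
  have happ : ∀ x : MonoidAlgebra k (GroupLike k H), MonoidAlgebra.liftGroupLikeBialgHom x =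
      Finsupp.linearCombination k (GroupLike.val (R := k) (A := H)) x.coeff := by
    intro x
    simp [MonoidAlgebra.liftGroupLikeBialgHom, MonoidAlgebra.lift_apply,
      Finsupp.linearCombination_apply]
  constructor
  · intro x y hxy
    rw [happ, happ] at hxy
    have := linearIndep_groupLikeVal hxy
    exact MonoidAlgebra.coeff_injective this
  · rw [← BialgHom.coe_toAlgHom, ← AlgHom.coe_toLinearMap, ← LinearMap.range_eq_top, eq_top_iff,
      ← span_isGroupLikeElem_eq_top, Submodule.span_le]
    intro g hg
    exact ⟨MonoidAlgebra.single ⟨g, hg⟩ 1, (happ _).trans (by simp)⟩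

end Dual

/-! ### Hopf actions: cocommutativity and the kernel -/

namespace VertexOperatorAlgebra

section Skew

variable {V : Type*} [AddCommGroup V] [Module ℂ V] (A : VertexOperatorAlgebra V)

theorem finite_support_mode_modeTensor (l : ℤ) (t : V ⊗[ℂ] V) (c : ℕ → ℂ) : (Function.support
    fun i : ℕ => c i • A.mode (-1 - i) (A.modeTensor (l + i) t) A.vacuum).Finite := by
  obtain ⟨N, hN⟩ := A.exists_modeTensor_eq_zero t
  refine (Set.finite_lt_nat (N - l).toNat).subset fun i hi => ?_
  by_contra h
  apply hi
  have h' : (N - l).toNat ≤ i := by simpa using h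
  simp only
  rw [hN _ (by omega)]
  simp

theorem modeTensor_comm (l : ℤ) (t : V ⊗[ℂ] V) :
    A.modeTensor l (TensorProduct.comm ℂ V V t) = ∑ᶠ i : ℕ, ((-1 : ℂ) ^ (l + i + 1)) •
      A.mode (-1 - i) (A.modeTensor (l + i) t) A.vacuum := by
  induction t using TensorProduct.induction_on with
  | zero => simp
  | tmul u v => simpa using A.mode_eq_finsum_mode_vacuum l u v
  | add x y hx hy =>
    simp only [map_add, LinearMap.add_apply, smul_add, hx, hy]
    rw [finsum_add_distrib (A.finite_support_mode_modeTensor l x _)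
      (A.finite_support_mode_modeTensor l y _)]

end Skew

/-- The linear map `h ↦ h v`. -/
def orbitMap (H : Type*) {V : Type*} [AddCommGroup V] [Module ℂ V] [Ring H] [Algebra ℂ H]
    [Module H V] [IsScalarTower ℂ H V] (v : V) : H →ₗ[ℂ] V :=
  (LinearMap.toSpanSingleton H V v).restrictScalars ℂ

section HopfAction

variable {V : Type*} [AddCommGroup V] [Module ℂ V]
variable {H : Type*} [Ring H] [HopfAlgebra ℂ H] [Module H V] [IsScalarTower ℂ H V]

@[simp]
theorem orbitMap_apply (h : H) (v : V) : orbitMap H v h = h • v := rfl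

theorem tensorMode_eq_modeTensor (A : VertexOperatorAlgebra V) (n : ℤ) (u v : V) (t : H ⊗[ℂ] H) :
    A.tensorMode n u v t =
      A.modeTensor n (TensorProduct.map (orbitMap H u) (orbitMap H v) t) := by
  induction t using TensorProduct.induction_on with
  | zero => simp
  | tmul g h => simp [tensorMode_tmul]
  | add x y hx hy => simp [hx, hy]

variable {A : VertexOperatorAlgebra V}

namespace IsHopfModule

variable (hH : A.IsHopfModule H)

include hH in
-- Evaluate `∑ (h₁𝟏)₋₁(h₂S(h₃)𝟏)` in two ways by coassociativity: it is `h𝟏`, and also `∑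
-- h₁(𝟏₋₁S(h₂)𝟏) = ε(h)𝟏`.
theorem smul_vacuum (h : H) : h • A.vacuum = Coalgebra.counit (R := ℂ) h • A.vacuum := by
  let S : H →ₗ[ℂ] H := HopfAlgebra.antipode ℂ
  let T : H ⊗[ℂ] (H ⊗[ℂ] H) →ₗ[ℂ] V := A.tensorMode (-1) A.vacuum A.vacuum ∘ₗ
    (LinearMap.mul' ℂ H ∘ₗ S.lTensor H).lTensor H
  have hT : ∀ (y : H ⊗[ℂ] H) (k : H), T (TensorProduct.assoc ℂ H H H (y ⊗ₜ k)) =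
      A.tensorMode (-1) A.vacuum (S k • A.vacuum) y := by
    intro y k
    induction y using TensorProduct.induction_on with
    | zero => simp
    | tmul a b => simp [T, tensorMode_tmul, mul_smul]
    | add x y hx hy => rw [TensorProduct.add_tmul, map_add, map_add, hx, hy, map_add]
  have hT' : ∀ x : H ⊗[ℂ] H, T (TensorProduct.assoc ℂ H H H (Coalgebra.comul.rTensor H x)) =
      (LinearMap.mul' ℂ H (S.lTensor H x)) • A.vacuum := by
    intro x
    induction x using TensorProduct.induction_on with
    | zero => simp
    | tmul a b =>
      rw [LinearMap.rTensor_tmul, hT, ← hH.smul_mode, A.vacuum_mode]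
      simp [mul_smul]
    | add x y hx hy => rw [map_add, map_add, map_add, hx, hy, map_add, map_add, add_smul]
  have h1 := hT' (Coalgebra.comul h)
  rw [Coalgebra.coassoc_apply, HopfAlgebra.mul_antipode_lTensor_comul_apply, algebraMap_smul] at h1
  rw [← h1]
  simp only [T, LinearMap.comp_apply]
  rw [← LinearMap.comp_apply (LinearMap.lTensor H _), ← LinearMap.lTensor_comp,
    LinearMap.comp_assoc, HopfAlgebra.mul_antipode_lTensor_comul, LinearMap.lTensor_comp_apply,
    Coalgebra.lTensor_counit_comul]
  simp [tensorMode_tmul, A.mode_vacuum]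

include hH in
theorem smul_mode_vacuum (h : H) (n : ℤ) (v : V) :
    h • A.mode n v A.vacuum = A.mode n (h • v) A.vacuum := by
  have key : ∀ t : H ⊗[ℂ] H, A.tensorMode n v A.vacuum t =
      A.mode n (TensorProduct.rid ℂ H (Coalgebra.counit.lTensor H t) • v) A.vacuum := by
    intro t
    induction t using TensorProduct.induction_on with
    | zero => simp
    | tmul a b => simp [tensorMode_tmul, hH.smul_vacuum b]
    | add x y hx hy => simp only [map_add, hx, hy, add_smul, LinearMap.add_apply]
  rw [hH.smul_mode, key, Coalgebra.lTensor_counit_comul]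
  simp

include hH in
theorem modeTensor_orbitMap_comul (h : H) (n : ℤ) (u v : V) : A.modeTensor n
    (TensorProduct.map (orbitMap H u) (orbitMap H v) (Coalgebra.comul (R := ℂ) h)) =
      h • A.mode n u v := by
  rw [hH.smul_mode, tensorMode_eq_modeTensor]

include hH in
-- Skew-symmetry rewrites the flipped sum through `(h(v_{n+i}u))_{-1-i}𝟏`. As `h` commutes with `a ↦
-- a_k 𝟏`, it factors out, and skew-symmetry again reassembles `u_n v`.
theorem modeTensor_orbitMap_comm_comul (h : H) (n : ℤ) (u v : V) : A.modeTensor n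
    (TensorProduct.map (orbitMap H u) (orbitMap H v)
      (TensorProduct.comm ℂ H H (Coalgebra.comul (R := ℂ) h))) = h • A.mode n u v := by
  rw [TensorProduct.map_comm, modeTensor_comm]
  simp only [hH.modeTensor_orbitMap_comul, ← hH.smul_mode_vacuum]
  rw [A.mode_eq_finsum_mode_vacuum n v u, ← DistribSMul.toAddMonoidHom_apply,
    AddMonoidHom.map_finsum]
  · refine finsum_congr fun i => ?_
    have := IsScalarTower.to_smulCommClass' (R := ℂ) (A := H) (M := V)
    exact (smul_comm h _ _).symm
  · have := A.finite_support_mode_modeTensor n (v ⊗ₜ u) fun i => (-1 : ℂ) ^ (n + i + 1)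
    simp only [modeTensor_tmul] at this
    exact this

include hH in
/-- A Hopf algebra acting faithfully on a simple vertex operator algebra is cocommutative. -/
theorem isCocomm (hA : A.IsSimple) (hf : Module.annihilator H V = ⊥) :
    Coalgebra.IsCocomm ℂ H where
  comm_comp_comul := by
    ext h
    have hinj : ∀ m : H, (∀ v : V, orbitMap H v m = 0) → m = 0 := fun m hm => by
      rw [← Submodule.mem_bot (R := H), ← hf]
      exact Module.mem_annihilator.2 hm
    -- By faithfulness the pairs of orbit maps separate the points of `H ⊗ H`.
    refine sub_eq_zero.1 (TensorProduct.eq_zero_of_forall_map_eq_zero (orbitMap H (V := V)) hinj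
      (orbitMap H (V := V)) hinj _ fun u v => ?_)
    rw [← Submodule.mem_bot ℂ, ← hA.modeKer_eq_bot, mem_modeKer]
    intro n
    rw [map_sub, map_sub, hH.modeTensor_orbitMap_comul, sub_eq_zero]
    exact hH.modeTensor_orbitMap_comm_comul h n u v

include hH in
/-- The kernel of the action on a simple vertex operator algebra is a coideal. -/
theorem isCoideal_annihilator (hA : A.IsSimple) :
    ((Module.annihilator H V).restrictScalars ℂ).IsCoideal where
  counit_eq_zero h hh := by
    have hv : A.vacuum ≠ 0 := by
      intro h0
      have := hA.1
      obtain ⟨v, hv⟩ := exists_ne (0 : V)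
      apply hv
      rw [← A.mode_vacuum v, h0, map_zero]
    have h1 := hH.smul_vacuum h
    rw [Module.mem_annihilator.1 hh] at h1
    exact (smul_eq_zero.1 h1.symm).resolve_right hv
  map_mkQ_comul_eq_zero h hh := by
    set K := (Module.annihilator H V).restrictScalars ℂ
    -- The orbit maps become jointly injective on `H ⧸ K`, so they detect the image of `Δ(h)` there.
    let f : V → (H ⧸ K) →ₗ[ℂ] V := fun v =>
      K.liftQ (orbitMap H v) fun k hk => Module.mem_annihilator.1 hk v
    have hf : ∀ v, f v ∘ₗ K.mkQ = orbitMap H v := fun v => LinearMap.ext fun _ => rfl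
    have hinj : ∀ m : H ⧸ K, (∀ v : V, f v m = 0) → m = 0 := by
      intro m hm
      obtain ⟨k, rfl⟩ := K.mkQ_surjective m
      exact (Submodule.Quotient.mk_eq_zero K).2 (Module.mem_annihilator.2 hm)
    refine TensorProduct.eq_zero_of_forall_map_eq_zero f hinj f hinj _ fun u v => ?_
    rw [← LinearMap.comp_apply, ← TensorProduct.map_comp, hf, hf, ← Submodule.mem_bot ℂ, ← hA.modeKer_eq_bot, mem_modeKer]
    intro n
    rw [hH.modeTensor_orbitMap_comul, Module.mem_annihilator.1 hh]

end IsHopfModule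

end HopfAction

end VertexOperatorAlgebra

end

/-! ### The theorem -/

theorem theorem6p5 {H V : Type*} [Ring H] [HopfAlgebra ℂ H] [Module.Finite ℂ H]
    [AddCommGroup V] [Module ℂ V] [Module H V] [IsScalarTower ℂ H V]
    (A : VertexOperatorAlgebra V) (hsimple : A.IsSimple)
    (haction : A.IsHopfModule H) (hss : IsSemisimpleModule H V) :
    ((Module.annihilator H V).IsTwoSided ∧ (Module.annihilator H V).IsHopfIdeal ℂ) ∧
      (IsInnerFaithful H V ↔ FaithfulSMul H V) ∧
      (IsInnerFaithful H V → IsGroupAlgebra H) := by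
  have htwo : (Module.annihilator H V).IsTwoSided := inferInstance
  have hco := haction.isCoideal_annihilator hsimple
  have hhopf : (Module.annihilator H V).IsHopfIdeal ℂ := Ideal.IsHopfIdeal.of_isCoideal _
  have hbot : IsInnerFaithful H V → Module.annihilator H V = ⊥ := by
    intro hin
    by_contra hne
    obtain ⟨h, hh, v, hv⟩ := hin _ htwo hhopf hne
    exact hv (Module.mem_annihilator.1 hh v)
  refine ⟨⟨htwo, hhopf⟩, ⟨fun hin => Module.annihilator_eq_bot.1 (hbot hin), ?_⟩, fun hin => ?_⟩
  · intro hf I _ _ hI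
    obtain ⟨h, hh, h0⟩ := Submodule.exists_mem_ne_zero_of_ne_bot hI
    refine ⟨h, hh, ?_⟩
    by_contra! hall
    exact h0 (hf.eq_of_smul_eq_smul fun v : V => by rw [hall v, zero_smul])
  · have := haction.isCocomm hsimple (hbot hin)
    exact ⟨GroupLike ℂ H, inferInstance, ⟨BialgEquiv.ofBijective
      MonoidAlgebra.liftGroupLikeBialgHom bijective_liftGroupLikeBialgHom⟩⟩
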